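/- A permutation of length $n\ge 1$ is a sequence $\sigma=(\sigma(1)\ldots\sigma(n))$ containing each of $1,\ldots,n$ exactly once. The standardization $\mathrm{st}[s]$ of a word $s$ of $k$ distinct positive integers is the permutation of length $k$ whose entries are in the same relative order as those of $s$. A permutation $\pi$ of length $l$ occurs in $\sigma$ at position $i$ ($1\le i\le n-l+1$) if $\mathrm{st}[\sigma(i)\ldots\sigma(i+l-1)]=\pi$; then $\pi$ is said to divide $\sigma$, and $\pi$ is a left (right) divisor of $\sigma$ if one can take $i=1$ ($i=n-l+1$). A collection of patterns is a set $\Pi$ of permutations that is reduced, i.e. no element of $\Pi$ divides another element of $\Pi$. Two collections $\Pi_1,\Pi_2$ are strongly c-Wilf equivalent if for all integers $n\ge 1$ and $0\le q<n$ the number of permutations of length $n$ with exactly $q$ occurrences of patterns from $\Pi_1$ (pairs of a pattern and a position) equals the number of those with exactly $q$ occurrences of patterns from $\Pi_2$. The graph $\mathcal G(\Pi)$ is the following directed multigraph (loops and multiple edges are allowed). Its vertices are the one-element permutation $(1)$ and all permutations $v$ that are a proper left divisor of some pattern in $\Pi$ and a proper right divisor of some (not necessarily different) pattern in $\Pi$,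 where a divisor of $\pi$ is proper if it is shorter than $\pi$. For every $\pi\in\Pi$, of length $l$, and all $1\le k,k'\le l$ such that $v=\mathrm{st}[\pi(1)\ldots\pi(k)]$ and $v'=\mathrm{st}[\pi(l-k'+1)\ldots\pi(l)]$ are vertices, there is one edge from $v$ to $v'$, with the label $(\mu_i,\mu_f;l)$, where $\mu_i=\{\pi(1),\ldots,\pi(k)\}$ and $\mu_f=\{\pi(l-k'+1),\ldots,\pi(l)\}$ are unordered sets. **Corollary 2.2.** Let $\Pi_1$ and $\Pi_2$ be collections of patterns such that $\mathcal G(\Pi_1)$ and $\mathcal G(\Pi_2)$ are isomorphic by an isomorphism of directed multigraphs (a bijection of the vertices together with a bijection of the edges that respects initial and final vertices) that preserves the labels of the edges; the permutations labelling the vertices may change. Then $\Pi_1$ and $\Pi_2$ are strongly c-Wilf equivalent. -/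

import Mathlib

namespace ConsecutivePatterns

/-- A permutation together with its length. Positions and values are `Fin n`, i.e. counted from
`0`; the entries of words and the edge labels below are shifted back to `1, …, n`. -/
structure Pattern where
  /-- the length -/
  length : ℕ
  /-- the underlying permutation -/
  perm : Equiv.Perm (Fin length)

/-- The one-element permutation `(1)`. -/
def Pattern.one : Pattern := ⟨1, 1⟩

/-- The standardization of a word `w` of length `k` with distinct entries: the inverse of the
permutation which sorts `w` increasingly. See `standardization_lt_iff` and
`eq_standardization` for the characterization. -/
def standardization {k : ℕ} (w : Fin k → ℕ) : Equiv.Perm (Fin k) := (Tuple.sort w).symm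

theorem standardization_lt_iff {k : ℕ} {w : Fin k → ℕ} (hw : Function.Injective w)
    (i j : Fin k) : standardization w i < standardization w j ↔ w i < w j := by
  have hm : StrictMono (w ∘ Tuple.sort w) :=
    (Tuple.monotone_sort w).strictMono_of_injective (hw.comp (Tuple.sort w).injective)
  have := hm.lt_iff_lt (a := standardization w i) (b := standardization w j)
  simpa [standardization] using this.symm

theorem eq_standardization {k : ℕ} {w : Fin k → ℕ} (hw : Function.Injective w)
    (τ : Equiv.Perm (Fin k)) (hτ : ∀ i j, τ i < τ j ↔ w i < w j) : τ = standardization w := by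
  have hm : StrictMono (τ ∘ (standardization w).symm) := by
    intro a b hab
    simp only [Function.comp, hτ]
    rw [← standardization_lt_iff hw]
    simpa using hab
  have hs : Function.Surjective (τ ∘ (standardization w).symm) :=
    τ.surjective.comp (standardization w).symm.surjective
  have h := Subsingleton.elim (hm.orderIsoOfSurjective _ hs) (OrderIso.refl (Fin k))
  ext i : 1
  have h2 := DFunLike.congr_fun h (standardization w i)
  simpa using h2

/-- The subword of `σ` of length `k` which starts after the first `i` entries. -/
def subword (σ : Pattern) (i k : ℕ) (h : i + k ≤ σ.length) : Fin k → ℕ :=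
  fun j => (σ.perm ⟨i + j, by omega⟩ : ℕ) + 1

theorem subword_injective (σ : Pattern) (i k : ℕ) (h : i + k ≤ σ.length) :
    Function.Injective (subword σ i k h) := by
  intro a b hab
  simp only [subword, Nat.add_right_cancel_iff] at hab
  have := σ.perm.injective (Fin.ext hab)
  simp only [Fin.mk.injEq] at this
  omega

/-- The subword of `σ` of length `k` after the first `i` entries, standardized. -/
def stSubword (σ : Pattern) (i k : ℕ) (h : i + k ≤ σ.length) : Pattern :=
  ⟨k, standardization (subword σ i k h)⟩

/-- The set of entries of the subword of `σ` of length `k` after the first `i` entries. -/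
def entrySet (σ : Pattern) (i k : ℕ) (h : i + k ≤ σ.length) : Finset ℕ :=
  Finset.univ.image (subword σ i k h)

/-- `π` occurs in `σ` as a consecutive pattern right after the first `i` entries of `σ`. -/
def OccursAt (π σ : Pattern) (i : ℕ) : Prop :=
  ∃ h : i + π.length ≤ σ.length, stSubword σ i π.length h = π

/-- `π ∣ σ`: the permutation `σ` contains `π` as a consecutive pattern. -/
def Divides (π σ : Pattern) : Prop := ∃ i, OccursAt π σ i

def IsLeftDivisor (π σ : Pattern) : Prop := OccursAt π σ 0

def IsRightDivisor (π σ : Pattern) : Prop := OccursAt π σ (σ.length - π.length)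

/-- No pattern of the collection is divisible by another one. -/
def IsReduced (P : Set Pattern) : Prop :=
  ∀ π ∈ P, ∀ π' ∈ P, Divides π π' → π = π'

/-- The occurrences (pattern, position) in `σ` of patterns from `P`. -/
def occurrences (P : Set Pattern) (σ : Pattern) : Set (Pattern × ℕ) :=
  {x | x.1 ∈ P ∧ OccursAt x.1 σ x.2}

theorem occurrences_finite (P : Set Pattern) (σ : Pattern) : (occurrences P σ).Finite := by
  refine Set.Finite.subset (Set.finite_range
    (fun y : (Σ i : Fin (σ.length + 1), Σ k : Fin (σ.length + 1), Equiv.Perm (Fin k)) =>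
      ((⟨y.2.1, y.2.2⟩ : Pattern), (y.1 : ℕ)))) ?_
  rintro ⟨⟨k, τ⟩, i⟩ ⟨-, h, -⟩
  simp only at h
  exact ⟨⟨⟨i, by omega⟩, ⟨k, by omega⟩, τ⟩, rfl⟩

/-- The number of permutations of length `n` with exactly `q` occurrences of patterns
from `P`. -/
noncomputable def countWithOccurrences (P : Set Pattern) (n q : ℕ) : ℕ :=
  {σ : Equiv.Perm (Fin n) | (occurrences P ⟨n, σ⟩).ncard = q}.ncard

def StronglyCWilfEquivalent (P₁ P₂ : Set Pattern) : Prop :=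
  ∀ n, 0 < n → ∀ q, q < n → countWithOccurrences P₁ n q = countWithOccurrences P₂ n q

/-- A directed multigraph (loops and multiple edges allowed) with edges labelled in `L`. -/
structure LabelledDigraph (L : Type) where
  /-- the vertices -/
  V : Type
  /-- the edges -/
  E : Type
  /-- the initial vertex of an edge -/
  source : E → V
  /-- the final vertex of an edge -/
  target : E → V
  /-- the label of an edge -/
  label : E → L

/-- An isomorphism of directed multigraphs which preserves the labels of edges. -/
structure LabelledDigraph.Iso {L : Type} (G H : LabelledDigraph L) where
  /-- the bijection of vertices -/
  onV : G.V ≃ H.V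
  /-- the bijection of edges -/
  onE : G.E ≃ H.E
  source_onE : ∀ e, H.source (onE e) = onV (G.source e)
  target_onE : ∀ e, H.target (onE e) = onV (G.target e)
  label_onE : ∀ e, H.label (onE e) = G.label e

/-- The permutations giving the vertices of the graph of `P`: the distinguished vertex `(1)`, and
every non-empty `v` which is a proper left divisor of a pattern from `P` and a proper right
divisor of a pattern from `P`. -/
def IsVertex (P : Set Pattern) (v : Pattern) : Prop :=
  v = Pattern.one ∨
    (0 < v.length ∧
      (∃ π ∈ P, v.length < π.length ∧ IsLeftDivisor v π) ∧
      (∃ π ∈ P, v.length < π.length ∧ IsRightDivisor v π))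

/-- The edges of the graph of `P`: a pattern `π ∈ P` of length `l` with its initial subword of
length `k` and its final subword of length `k'`, both of which standardize to vertices. -/
structure Edge (P : Set Pattern) where
  /-- the pattern -/
  π : Pattern
  mem : π ∈ P
  /-- the length of the initial subword -/
  k : ℕ
  /-- the length of the final subword -/
  k' : ℕ
  hk : k ≤ π.length
  hk' : k' ≤ π.length
  initial_isVertex : IsVertex P (stSubword π 0 k (by omega))
  final_isVertex : IsVertex P (stSubword π (π.length - k') k' (by omega))

/-- The graph of a collection of patterns. An edge is labelled by the (unordered) sets of entries
of its initial and of its final subword and by the length of the pattern. -/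
def patternGraph (P : Set Pattern) : LabelledDigraph (Finset ℕ × Finset ℕ × ℕ) where
  V := {v : Pattern // IsVertex P v}
  E := Edge P
  source e := ⟨_, e.initial_isVertex⟩
  target e := ⟨_, e.final_isVertex⟩
  label e :=
    (entrySet e.π 0 e.k (by have := e.hk; omega),
      entrySet e.π (e.π.length - e.k') e.k' (by have := e.hk'; omega),
      e.π.length)

end ConsecutivePatterns

namespace ConsecutivePatterns

/-! ### Patterns as permutations of `ℕ` -/

/-! By inclusion–exclusion (`card_card_eq_of_card_subset_eq`) it is enough that, for every finite
set `J` of intervals, equally many `σ` have occurrences at least on all intervals of `J` for both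
collections. The isomorphism and its inverse each give an injection between these two sets of
permutations.

Fix `J` and such a `σ`. As the collection is reduced, the intervals of `J` form an antichain, so the
largest overlaps of an interval are those with its neighbours, and an overlap standardizes to a
proper right divisor of one pattern and a proper left divisor of the next: a vertex. Where there is
no overlap, the vertex `(1)` serves instead. So each interval gives an edge (`edgeAt`), and
overlapping neighbours give consecutive edges. The isomorphism replaces the pattern `π` on an
interval by some `π'` of the same length; rearranging the positions there by `π⁻¹ ∘ π'` turns `π`
into `π'`.

These rearrangements agree on overlaps (`edgeReindex_adjacent`). Since labels are preserved, `π` and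
`π'` have the same entries on the initial block and on the final block. Hence `π⁻¹ ∘ π'` preserves
each block and acts there as `v⁻¹ ∘ v'`, where `v` is the vertex and `v'` its image, which is common
to the two edges meeting at `v`. The glued permutation `τ` of positions yields `σ * τ`, and `σ` can
be recovered from it (`transfer_injective`). -/

/-- The permutation of `ℕ` that acts as `σ` below the length of `σ` and fixes all else. -/
def Pattern.extend (σ : Pattern) : Equiv.Perm ℕ := σ.perm.extendDomain Fin.equivSubtype

theorem Pattern.extend_apply (σ : Pattern) {i : ℕ} (h : i < σ.length) :
    σ.extend i = σ.perm ⟨i, h⟩ :=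
  Equiv.Perm.extendDomain_apply_image σ.perm Fin.equivSubtype ⟨i, h⟩

theorem Pattern.extend_lt_iff (σ : Pattern) {i : ℕ} : σ.extend i < σ.length ↔ i < σ.length := by
  by_cases h : i < σ.length
  · simp [σ.extend_apply h, h]
  · rw [Pattern.extend, Equiv.Perm.extendDomain_apply_not_subtype σ.perm Fin.equivSubtype h]

theorem Pattern.extend_symm_lt_iff (σ : Pattern) {i : ℕ} :
    σ.extend.symm i < σ.length ↔ i < σ.length := by
  rw [← σ.extend_lt_iff, Equiv.apply_symm_apply]

theorem stSubword_extend_lt_iff (σ : Pattern) {i k : ℕ} (h : i + k ≤ σ.length) {x y : ℕ}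
    (hx : x < k) (hy : y < k) :
    (stSubword σ i k h).extend x < (stSubword σ i k h).extend y ↔
      σ.extend (i + x) < σ.extend (i + y) := by
  rw [Pattern.extend_apply _ (show x < (stSubword σ i k h).length from hx),
    Pattern.extend_apply _ (show y < (stSubword σ i k h).length from hy),
    σ.extend_apply (by omega), σ.extend_apply (by omega), Fin.val_fin_lt]
  refine (standardization_lt_iff (subword_injective σ i k h) ⟨x, hx⟩ ⟨y, hy⟩).trans ?_
  simp [subword]

theorem stSubword_eq_iff {σ π : Pattern} {i k : ℕ} (h : i + k ≤ σ.length) :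
    stSubword σ i k h = π ↔ k = π.length ∧ ∀ x y, x < k → y < k →
      (π.extend x < π.extend y ↔ σ.extend (i + x) < σ.extend (i + y)) := by
  constructor
  · rintro rfl
    exact ⟨rfl, fun x y hx hy => stSubword_extend_lt_iff σ h hx hy⟩
  · obtain ⟨l, τ⟩ := π
    rintro ⟨hl, hlt⟩
    obtain rfl : k = l := hl
    have hτ : τ = standardization (subword σ i k h) := by
      refine eq_standardization (subword_injective σ i k h) τ fun x y => ?_
      have := hlt x y x.2 y.2
      rw [Pattern.extend_apply _ x.2, Pattern.extend_apply _ y.2, σ.extend_apply (by omega),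
        σ.extend_apply (by omega), Fin.val_fin_lt] at this
      simpa [subword] using this
    rw [hτ]
    rfl

theorem stSubword_stSubword (σ : Pattern) {s l i k : ℕ} (h : s + l ≤ σ.length)
    (h' : i + k ≤ l) :
    stSubword (stSubword σ s l h) i k h' = stSubword σ (s + i) k (by omega) := by
  refine (stSubword_eq_iff _).2 ⟨rfl, fun x y hx hy => ?_⟩
  rw [stSubword_extend_lt_iff _ _ hx hy, stSubword_extend_lt_iff _ h (by omega) (by omega)]
  simp only [add_assoc]

theorem stSubword_congr (σ : Pattern) {i j k m : ℕ} (h : i + k ≤ σ.length) (hij : i = j)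
    (hkm : k = m) : stSubword σ i k h = stSubword σ j m (by omega) := by
  subst hij hkm
  rfl

theorem stSubword_one (σ : Pattern) {i k : ℕ} (h : i + k ≤ σ.length) (hk : k = 1) :
    stSubword σ i k h = Pattern.one := by
  subst hk
  exact congrArg (Pattern.mk 1) (Subsingleton.elim _ _)

theorem mem_entrySet {σ : Pattern} {i k : ℕ} (h : i + k ≤ σ.length) {m : ℕ} :
    m ∈ entrySet σ i k h ↔ ∃ x < k, σ.extend (i + x) + 1 = m := by
  simp only [entrySet, Finset.mem_image, Finset.mem_univ, true_and, subword]
  constructor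
  · rintro ⟨x, rfl⟩
    exact ⟨x, x.2, by rw [σ.extend_apply (by omega)]⟩
  · rintro ⟨x, hx, rfl⟩
    exact ⟨⟨x, hx⟩, by rw [σ.extend_apply (by omega)]⟩

theorem card_entrySet {σ : Pattern} {i k : ℕ} (h : i + k ≤ σ.length) :
    (entrySet σ i k h).card = k := by
  rw [entrySet, Finset.card_image_of_injective _ (subword_injective σ i k h), Finset.card_fin]

/-! ### Reindexing from one pattern to another -/

/-- The permutation of positions that turns the word `π` into the word `π'`. -/
def reindex (π π' : Pattern) : Equiv.Perm ℕ := π'.extend.trans π.extend.symm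

theorem extend_reindex (π π' : Pattern) (x : ℕ) :
    π.extend (reindex π π' x) = π'.extend x := by simp [reindex]

theorem reindex_lt_iff {π π' : Pattern} {l : ℕ} (h : π.length = l) (h' : π'.length = l) {x : ℕ} :
    reindex π π' x < l ↔ x < l := by
  rw [← h, ← π.extend_lt_iff, extend_reindex, h, ← h', π'.extend_lt_iff]

/-- The inverse of the standardized block lists the positions of the block by increasing entry. -/
theorem strictMono_extend_stSubword_symm (π : Pattern) {a k : ℕ} (h : a + k ≤ π.length) :
    StrictMono fun x : Fin k => π.extend (a + (stSubword π a k h).extend.symm x) := by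
  intro x y hxy
  have key (z : Fin k) : (stSubword π a k h).extend.symm z < k :=
    (stSubword π a k h).extend_symm_lt_iff.2 z.2
  refine (stSubword_extend_lt_iff π h (key x) (key y)).1 ?_
  simpa using hxy

theorem range_extend_stSubword_symm (π : Pattern) {a k : ℕ} (h : a + k ≤ π.length) :
    Set.range (fun x : Fin k => π.extend (a + (stSubword π a k h).extend.symm x)) =
      {m | m + 1 ∈ entrySet π a k h} := by
  ext m
  simp only [Set.mem_range, Set.mem_ofPred_eq, mem_entrySet, Nat.add_right_cancel_iff]
  constructor
  · rintro ⟨x, rfl⟩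
    exact ⟨_, (stSubword π a k h).extend_symm_lt_iff.2 x.2, rfl⟩
  · rintro ⟨x, hx, rfl⟩
    exact ⟨⟨(stSubword π a k h).extend x, (stSubword π a k h).extend_lt_iff.2 hx⟩, by simp⟩

/-- If two patterns have the same set of entries on a block, then the reindexing from one to the
other is, on this block, the reindexing of the standardized blocks. -/
theorem reindex_add_of_entrySet_eq {π π' : Pattern} {a a' k k' : ℕ} (h : a + k ≤ π.length)
    (h' : a' + k' ≤ π'.length) (ha : a' = a) (hk : k' = k)
    (hE : entrySet π' a' k' h' = entrySet π a k h) {x : ℕ} (hx : x < k) :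
    reindex π π' (a + x) = a + reindex (stSubword π a k h) (stSubword π' a' k' h') x := by
  subst ha hk
  -- Two increasing enumerations of the same set of entries coincide.
  have hfun := (StrictMono.range_inj (strictMono_extend_stSubword_symm π h)
    (strictMono_extend_stSubword_symm π' h')).1 (by
      rw [range_extend_stSubword_symm, range_extend_stSubword_symm, hE])
  have := congrFun hfun ⟨_, (stSubword π' a' k' h').extend_lt_iff.2 hx⟩
  simp only [Equiv.symm_apply_apply] at this
  simp only [reindex, Equiv.trans_apply, ← this, Equiv.symm_apply_apply]

/-! ### Occurrences as intervals -/

open Classical in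
/-- The intervals `(s, l)`, with start `s` and length `l`, on which `σ` standardizes to an
element of `P`. -/
noncomputable def occurrenceIntervals (P : Set Pattern) {n : ℕ} (σ : Equiv.Perm (Fin n)) :
    Finset (ℕ × ℕ) :=
  (Finset.range (n + 1) ×ˢ Finset.range (n + 1)).filter
    fun I => ∃ h : I.1 + I.2 ≤ n, stSubword ⟨n, σ⟩ I.1 I.2 h ∈ P

theorem mem_occurrenceIntervals {P : Set Pattern} {n : ℕ} {σ : Equiv.Perm (Fin n)} {I : ℕ × ℕ} :
    I ∈ occurrenceIntervals P σ ↔ ∃ h : I.1 + I.2 ≤ n, stSubword ⟨n, σ⟩ I.1 I.2 h ∈ P := by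
  simp only [occurrenceIntervals, Finset.mem_filter, Finset.mem_product, Finset.mem_range,
    and_iff_right_iff_imp]
  rintro ⟨h, -⟩
  omega

/-- An interval determines the pattern that occurs on it, so the pattern can be dropped. -/
theorem ncard_occurrences (P : Set Pattern) {n : ℕ} (σ : Equiv.Perm (Fin n)) :
    (occurrences P ⟨n, σ⟩).ncard = (occurrenceIntervals P σ).card := by
  rw [← Set.ncard_coe_finset]
  refine Set.ncard_congr (fun x _ => (x.2, x.1.length)) ?_ ?_ ?_
  · rintro ⟨π, i⟩ ⟨hπ, h, hst⟩
    exact Finset.mem_coe.2 (mem_occurrenceIntervals.2 ⟨h, by simpa only [hst] using hπ⟩)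
  · rintro ⟨π, i⟩ ⟨π', i'⟩ ⟨-, h, hst⟩ ⟨-, h', hst'⟩ heq
    simp only [Prod.mk.injEq] at heq
    obtain ⟨rfl, hl⟩ := heq
    simp only at hst hst'
    rw [Prod.mk.injEq, ← hst, ← hst']
    exact ⟨stSubword_congr _ _ rfl hl, rfl⟩
  · rintro ⟨s, l⟩ hI
    obtain ⟨h, hP⟩ := mem_occurrenceIntervals.1 (Finset.mem_coe.1 hI)
    exact ⟨(stSubword ⟨n, σ⟩ s l h, s), ⟨hP, h, rfl⟩, rfl⟩

/-- In a reduced collection no interval of an occurrence contains another one. -/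
theorem eq_of_mem_occurrenceIntervals {P : Set Pattern} (hred : IsReduced P) {n : ℕ}
    {σ : Equiv.Perm (Fin n)} {I I' : ℕ × ℕ} (hI : I ∈ occurrenceIntervals P σ)
    (hI' : I' ∈ occurrenceIntervals P σ) (hs : I'.1 ≤ I.1) (he : I.1 + I.2 ≤ I'.1 + I'.2) :
    I = I' := by
  obtain ⟨h, hP⟩ := mem_occurrenceIntervals.1 hI
  obtain ⟨h', hP'⟩ := mem_occurrenceIntervals.1 hI'
  have hdvd : Divides (stSubword ⟨n, σ⟩ I.1 I.2 h) (stSubword ⟨n, σ⟩ I'.1 I'.2 h') := by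
    refine ⟨I.1 - I'.1, show I.1 - I'.1 + I.2 ≤ I'.2 by omega, ?_⟩
    exact (stSubword_stSubword _ _ _).trans (stSubword_congr _ _ (by omega) rfl)
  have hl : I.2 = I'.2 := congrArg Pattern.length (hred _ hP _ hP' hdvd)
  exact Prod.ext (by omega) hl

/-! ### Overlaps in a set of intervals -/

/-- The length of the largest overlap of `I` with an interval of `J` that starts before `I`,
but at least `1`. -/
def leftOverlap (J : Finset (ℕ × ℕ)) (I : ℕ × ℕ) : ℕ :=
  max 1 ((J.filter fun I' => I'.1 < I.1).sup fun I' => I'.1 + I'.2 - I.1)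

/-- The length of the largest overlap of `I` with an interval of `J` that starts after `I`,
but at least `1`. -/
def rightOverlap (J : Finset (ℕ × ℕ)) (I : ℕ × ℕ) : ℕ :=
  max 1 ((J.filter fun I' => I.1 < I'.1).sup fun I' => I.1 + I.2 - I'.1)

/-- Positivity of the attained value matters because `f` will be a truncated difference, which is
then a true one. -/
theorem max_one_sup_eq {α : Type*} (S : Finset α) (f : α → ℕ) :
    max 1 (S.sup f) = 1 ∨ ∃ a ∈ S, f a = max 1 (S.sup f) ∧ 0 < f a := by
  rcases le_or_gt (S.sup f) 1 with h | h
  · exact Or.inl (max_eq_left h)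
  · have hne : S.Nonempty := by
      rw [Finset.nonempty_iff_ne_empty]
      rintro rfl
      simp at h
    obtain ⟨a, ha, hfa⟩ := Finset.exists_mem_eq_sup S hne f
    exact Or.inr ⟨a, ha, by omega, by omega⟩

theorem leftOverlap_cases (J : Finset (ℕ × ℕ)) (I : ℕ × ℕ) :
    leftOverlap J I = 1 ∨
      ∃ I' ∈ J, I'.1 < I.1 ∧ I'.1 + I'.2 = I.1 + leftOverlap J I := by
  rcases max_one_sup_eq (J.filter fun I' => I'.1 < I.1) (fun I' => I'.1 + I'.2 - I.1) with
    h | ⟨I', hI', h, h0⟩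
  · exact Or.inl h
  · rw [Finset.mem_filter] at hI'
    refine Or.inr ⟨I', hI'.1, hI'.2, ?_⟩
    rw [leftOverlap, ← h]
    omega

theorem rightOverlap_cases (J : Finset (ℕ × ℕ)) (I : ℕ × ℕ) :
    rightOverlap J I = 1 ∨
      ∃ I' ∈ J, I.1 < I'.1 ∧ I.1 + I.2 = I'.1 + rightOverlap J I := by
  rcases max_one_sup_eq (J.filter fun I' => I.1 < I'.1) (fun I' => I.1 + I.2 - I'.1) with
    h | ⟨I', hI', h, h0⟩
  · exact Or.inl h
  · rw [Finset.mem_filter] at hI'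
    refine Or.inr ⟨I', hI'.1, hI'.2, ?_⟩
    rw [rightOverlap, ← h]
    omega

theorem one_le_leftOverlap (J : Finset (ℕ × ℕ)) (I : ℕ × ℕ) : 1 ≤ leftOverlap J I :=
  le_max_left _ _

theorem one_le_rightOverlap (J : Finset (ℕ × ℕ)) (I : ℕ × ℕ) : 1 ≤ rightOverlap J I :=
  le_max_left _ _

/-- No interval of `J` contains another one. -/
def IsIntervalAntichain (J : Finset (ℕ × ℕ)) : Prop :=
  ∀ I ∈ J, ∀ I' ∈ J, I'.1 ≤ I.1 → I.1 + I.2 ≤ I'.1 + I'.2 → I = I'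

theorem IsIntervalAntichain.end_lt {J : Finset (ℕ × ℕ)} (hJ : IsIntervalAntichain J)
    {I I' : ℕ × ℕ} (hI : I ∈ J) (hI' : I' ∈ J) (h : I.1 < I'.1) :
    I.1 + I.2 < I'.1 + I'.2 := by
  by_contra hc
  have := hJ I' hI' I hI h.le (by omega)
  simp [this] at h

theorem IsIntervalAntichain.end_le {J : Finset (ℕ × ℕ)} (hJ : IsIntervalAntichain J)
    {I I' : ℕ × ℕ} (hI : I ∈ J) (hI' : I' ∈ J) (h : I.1 ≤ I'.1) :
    I.1 + I.2 ≤ I'.1 + I'.2 := by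
  by_contra hc
  have := hJ I' hI' I hI h (by omega)
  simp [this] at hc

theorem rightOverlap_eq {J : Finset (ℕ × ℕ)} {I I' : ℕ × ℕ} (hI' : I' ∈ J) (hlt : I.1 < I'.1)
    (hnext : ∀ I'' ∈ J, I.1 < I''.1 → I'.1 ≤ I''.1) (hov : I'.1 < I.1 + I.2) :
    rightOverlap J I = I.1 + I.2 - I'.1 := by
  apply le_antisymm
  · refine max_le (by omega) (Finset.sup_le fun I'' h => ?_)
    rw [Finset.mem_filter] at h
    have := hnext I'' h.1 h.2
    omega
  · exact le_max_of_le_right (Finset.le_sup (f := fun I' : ℕ × ℕ => I.1 + I.2 - I'.1)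
      (Finset.mem_filter.2 ⟨hI', hlt⟩))

/-- By the antichain property, among the intervals starting before `I'` the last one to start also
ends last. -/
theorem leftOverlap_eq {J : Finset (ℕ × ℕ)} (hJ : IsIntervalAntichain J) {I I' : ℕ × ℕ}
    (hI : I ∈ J) (hlt : I.1 < I'.1) (hnext : ∀ I'' ∈ J, I.1 < I''.1 → I'.1 ≤ I''.1)
    (hov : I'.1 < I.1 + I.2) : leftOverlap J I' = I.1 + I.2 - I'.1 := by
  apply le_antisymm
  · refine max_le (by omega) (Finset.sup_le fun I'' h => ?_)
    rw [Finset.mem_filter] at h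
    have hle : I''.1 ≤ I.1 := by
      by_contra hc
      have := hnext I'' h.1 (by omega)
      omega
    have := hJ.end_le h.1 hI hle
    omega
  · exact le_max_of_le_right (Finset.le_sup (f := fun I : ℕ × ℕ => I.1 + I.2 - I'.1)
      (Finset.mem_filter.2 ⟨hI, hlt⟩))

/-! ### Gluing local reindexings -/

open Classical in
/-- The map that acts on each interval `I` of `J` as the translate of `ρ I`. -/
noncomputable def glue (J : Finset (ℕ × ℕ)) (ρ : J → Equiv.Perm ℕ) (p : ℕ) : ℕ :=
  if h : ∃ I : J, I.1.1 ≤ p ∧ p < I.1.1 + I.1.2 then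
    h.choose.1.1 + ρ h.choose (p - h.choose.1.1) else p

/-- The maps glued by `glue` agree where the intervals meet. -/
def Compatible (J : Finset (ℕ × ℕ)) (ρ : J → Equiv.Perm ℕ) : Prop :=
  ∀ I I' : J, ∀ p, I.1.1 ≤ p → p < I.1.1 + I.1.2 → I'.1.1 ≤ p → p < I'.1.1 + I'.1.2 →
    I.1.1 + ρ I (p - I.1.1) = I'.1.1 + ρ I' (p - I'.1.1)

theorem Compatible.glue_add {J : Finset (ℕ × ℕ)} {ρ : J → Equiv.Perm ℕ} (hρ : Compatible J ρ)
    (I : J) {x : ℕ} (hx : x < I.1.2) : glue J ρ (I.1.1 + x) = I.1.1 + ρ I x := by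
  have h : ∃ I' : J, I'.1.1 ≤ I.1.1 + x ∧ I.1.1 + x < I'.1.1 + I'.1.2 :=
    ⟨I, by omega, by omega⟩
  rw [glue, dif_pos h, hρ h.choose I _ h.choose_spec.1 h.choose_spec.2 (by omega) (by omega),
    Nat.add_sub_cancel_left]

/-- Each `ρ I` permutes its own interval, so preimages are found interval by interval; finiteness
gives injectivity. -/
theorem Compatible.exists_perm {J : Finset (ℕ × ℕ)} {ρ : J → Equiv.Perm ℕ}
    (hρ : Compatible J ρ) (hlt : ∀ (I : J) x, ρ I x < I.1.2 ↔ x < I.1.2) {n : ℕ}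
    (hn : ∀ I ∈ J, I.1 + I.2 ≤ n) :
    ∃ τ : Equiv.Perm (Fin n), ∀ p, (τ p : ℕ) = glue J ρ p := by
  have hmaps (p : Fin n) : glue J ρ p < n := by
    by_cases h : ∃ I : J, I.1.1 ≤ p ∧ p < I.1.1 + I.1.2
    · obtain ⟨I, h1, h2⟩ := h
      obtain ⟨x, hx⟩ := Nat.exists_eq_add_of_le h1
      have hxl : x < I.1.2 := by omega
      have := (hlt I x).2 hxl
      have := hn I.1 I.2
      rw [hx, hρ.glue_add I hxl]
      omega
    · rw [glue, dif_neg h]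
      exact p.2
  have hsurj : Function.Surjective fun p : Fin n => (⟨glue J ρ p, hmaps p⟩ : Fin n) := by
    intro q
    by_cases h : ∃ I : J, I.1.1 ≤ q ∧ q < I.1.1 + I.1.2
    · obtain ⟨I, h1, h2⟩ := h
      obtain ⟨y, hy⟩ := Nat.exists_eq_add_of_le h1
      have hyl : (ρ I).symm y < I.1.2 := by
        rw [← hlt, Equiv.apply_symm_apply]
        omega
      have := hn I.1 I.2
      refine ⟨⟨I.1.1 + (ρ I).symm y, by omega⟩, Fin.ext ?_⟩
      simp only [hρ.glue_add I hyl, Equiv.apply_symm_apply, hy]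
    · exact ⟨q, Fin.ext (by simp only [glue, dif_neg h])⟩
  exact ⟨Equiv.ofBijective _ (Finite.injective_iff_bijective.1
    (Finite.injective_iff_surjective.2 hsurj)), fun p => rfl⟩

/-- For an antichain of intervals, agreement on overlaps of neighbours suffices. -/
theorem compatible_of_neighbours {J : Finset (ℕ × ℕ)} (hJ : IsIntervalAntichain J)
    {ρ : J → Equiv.Perm ℕ}
    (hρ : ∀ I I' : J, I.1.1 < I'.1.1 → (∀ I'' ∈ J, I.1.1 < I''.1 → I'.1.1 ≤ I''.1) →
      ∀ p, I'.1.1 ≤ p → p < I.1.1 + I.1.2 →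
        I.1.1 + ρ I (p - I.1.1) = I'.1.1 + ρ I' (p - I'.1.1)) : Compatible J ρ := by
  -- Induction on the distance of the starts: the interval `K` next after `I` starts no later than
  -- `I'` and ends after `I`, so it contains `p`; compare `I` with `K`, then `K` with `I'`.
  have key : ∀ (d : ℕ) (I I' : J), I'.1.1 - I.1.1 = d → I.1.1 < I'.1.1 → ∀ p, I'.1.1 ≤ p →
      p < I.1.1 + I.1.2 → I.1.1 + ρ I (p - I.1.1) = I'.1.1 + ρ I' (p - I'.1.1) := by
    intro d
    induction d using Nat.strong_induction_on with
    | _ d ih =>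
      intro I I' hd hlt p hp hp'
      obtain ⟨K, hK, hmin⟩ := Finset.exists_min_image (J.filter fun K => I.1.1 < K.1)
        (fun K => K.1) ⟨I'.1, Finset.mem_filter.2 ⟨I'.2, hlt⟩⟩
      rw [Finset.mem_filter] at hK
      have hKI' := hmin I'.1 (Finset.mem_filter.2 ⟨I'.2, hlt⟩)
      have hend := hJ.end_lt I.2 hK.1 hK.2
      have h1 := hρ I ⟨K, hK.1⟩ hK.2
        (fun I'' h h' => hmin I'' (Finset.mem_filter.2 ⟨h, h'⟩)) p (by simp only; omega) hp'
      rcases hKI'.eq_or_lt with heq | hlt'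
      · obtain rfl : K = I'.1 := by
          refine hJ _ hK.1 _ I'.2 heq.ge (hJ.end_le hK.1 I'.2 heq.le)
        exact h1
      · exact h1.trans (ih (I'.1.1 - K.1) (by omega) ⟨K, hK.1⟩ I' rfl hlt' p hp
          (by simp only; omega))
  intro I I' p h1 h2 h3 h4
  rcases lt_trichotomy I.1.1 I'.1.1 with h | h | h
  · exact key _ I I' rfl h p h3 h2
  · obtain rfl : I = I' := by
      refine Subtype.ext (hJ _ I.2 _ I'.2 h.ge (hJ.end_le I.2 I'.2 h.le))
    rfl
  · exact (key _ I' I rfl h p h1 h4).symm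

/-! ### The edges of an interval set of occurrences -/

section Transfer

variable {P P' : Set Pattern} {n : ℕ} {σ : Equiv.Perm (Fin n)} {J : Finset (ℕ × ℕ)}

theorem isIntervalAntichain_of_subset (hred : IsReduced P) (hJ : J ⊆ occurrenceIntervals P σ) :
    IsIntervalAntichain J :=
  fun _ hI _ hI' => eq_of_mem_occurrenceIntervals hred (hJ hI) (hJ hI')

theorem end_le_of_subset (hJ : J ⊆ occurrenceIntervals P σ) {I : ℕ × ℕ} (hI : I ∈ J) :
    I.1 + I.2 ≤ n := (mem_occurrenceIntervals.1 (hJ hI)).1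

theorem stSubword_mem_of_subset (hJ : J ⊆ occurrenceIntervals P σ) {I : ℕ × ℕ} (hI : I ∈ J) :
    stSubword ⟨n, σ⟩ I.1 I.2 (end_le_of_subset hJ hI) ∈ P :=
  (mem_occurrenceIntervals.1 (hJ hI)).2

theorem leftOverlap_le (hpos : ∀ π ∈ P, 0 < π.length) (hred : IsReduced P)
    (hJ : J ⊆ occurrenceIntervals P σ) {I : ℕ × ℕ} (hI : I ∈ J) : leftOverlap J I ≤ I.2 := by
  have h0 : 0 < I.2 := hpos _ (stSubword_mem_of_subset hJ hI)
  rcases leftOverlap_cases J I with h | ⟨I', hI', hlt, h⟩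
  · omega
  · have := (isIntervalAntichain_of_subset hred hJ).end_lt hI' hI hlt
    omega

theorem rightOverlap_le (hpos : ∀ π ∈ P, 0 < π.length)
    (hJ : J ⊆ occurrenceIntervals P σ) {I : ℕ × ℕ} (hI : I ∈ J) : rightOverlap J I ≤ I.2 := by
  have h0 : 0 < I.2 := hpos _ (stSubword_mem_of_subset hJ hI)
  rcases rightOverlap_cases J I with h | ⟨I', hI', hlt, h⟩ <;> omega

/-- The overlap of two intervals of occurrences standardizes to a vertex. -/
theorem isVertex_overlap (hred : IsReduced P) (hJ : J ⊆ occurrenceIntervals P σ) {I I' : ℕ × ℕ}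
    (hI : I ∈ J) (hI' : I' ∈ J) (hlt : I.1 < I'.1) {k : ℕ} (hk : 0 < k)
    (hov : I.1 + I.2 = I'.1 + k) (h : I'.1 + k ≤ n) :
    IsVertex P (stSubword ⟨n, σ⟩ I'.1 k h) := by
  have hend := (isIntervalAntichain_of_subset hred hJ).end_lt hI hI' hlt
  refine Or.inr ⟨hk, ⟨_, stSubword_mem_of_subset hJ hI', show k < I'.2 by omega, ?_⟩,
    ⟨_, stSubword_mem_of_subset hJ hI, show k < I.2 by omega, ?_⟩⟩
  · exact ⟨show 0 + k ≤ I'.2 by omega, stSubword_stSubword _ _ _⟩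
  · refine ⟨show I.2 - k + k ≤ I.2 by omega, (stSubword_stSubword _ _ _).trans ?_⟩
    exact stSubword_congr _ _ (show I.1 + (I.2 - k) = I'.1 by omega) rfl

/-- The edge given by the pattern on an interval and its overlaps with the neighbours. -/
def edgeAt (hpos : ∀ π ∈ P, 0 < π.length) (hred : IsReduced P)
    (hJ : J ⊆ occurrenceIntervals P σ) (I : J) : Edge P where
  π := stSubword ⟨n, σ⟩ I.1.1 I.1.2 (end_le_of_subset hJ I.2)
  mem := stSubword_mem_of_subset hJ I.2
  k := leftOverlap J I
  k' := rightOverlap J I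
  hk := leftOverlap_le hpos hred hJ I.2
  hk' := rightOverlap_le hpos hJ I.2
  initial_isVertex := by
    have hle := leftOverlap_le hpos hred hJ I.2
    have hn := end_le_of_subset hJ I.2
    rcases leftOverlap_cases J I with h | ⟨I', hI', hlt, h⟩
    · exact Or.inl (stSubword_one _ _ h)
    · rw [stSubword_stSubword _ _ (by omega)]
      exact isVertex_overlap hred hJ hI' I.2 hlt (one_le_leftOverlap J I) h _
  final_isVertex := by
    have hle := rightOverlap_le hpos hJ I.2
    have hn := end_le_of_subset hJ I.2
    rcases rightOverlap_cases J I with h | ⟨I', hI', hlt, h⟩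
    · exact Or.inl (stSubword_one _ _ h)
    · have hv := isVertex_overlap hred hJ I.2 hI' hlt (one_le_rightOverlap J I) h (by omega)
      refine cast (congrArg _ ?_) hv
      refine ((stSubword_stSubword _ _ (show I.1.2 - _ + _ ≤ _ by omega)).trans
        (stSubword_congr _ _ (show I.1.1 + (I.1.2 - _) = _ by omega) rfl)).symm

theorem edgeAt_k (hpos : ∀ π ∈ P, 0 < π.length) (hred : IsReduced P)
    (hJ : J ⊆ occurrenceIntervals P σ) (I : J) :
    (edgeAt hpos hred hJ I).k = leftOverlap J I := rfl

theorem edgeAt_k' (hpos : ∀ π ∈ P, 0 < π.length) (hred : IsReduced P)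
    (hJ : J ⊆ occurrenceIntervals P σ) (I : J) :
    (edgeAt hpos hred hJ I).k' = rightOverlap J I := rfl

theorem Edge.ext_of_eq {e e' : Edge P} (hπ : e.π = e'.π) (hk : e.k = e'.k)
    (hk' : e.k' = e'.k') : e = e' := by
  cases e
  cases e'
  cases hπ
  cases hk
  cases hk'
  rfl

/-! ### Action of a graph isomorphism on edges. -/

variable (φ : LabelledDigraph.Iso (patternGraph P) (patternGraph P'))

/-- The image of an edge under an isomorphism of graphs. -/
def mapEdge (e : Edge P) : Edge P' := φ.onE e

theorem mapEdge_injective : Function.Injective (mapEdge φ) := φ.onE.injective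

theorem mapEdge_length (e : Edge P) : (mapEdge φ e).π.length = e.π.length :=
  congrArg (fun x => x.2.2) (φ.label_onE e)

theorem mapEdge_initial (e : Edge P) :
    entrySet (mapEdge φ e).π 0 (mapEdge φ e).k (by have := (mapEdge φ e).hk; omega) =
      entrySet e.π 0 e.k (by have := e.hk; omega) :=
  congrArg (fun x => x.1) (φ.label_onE e)

theorem mapEdge_final (e : Edge P) :
    entrySet (mapEdge φ e).π ((mapEdge φ e).π.length - (mapEdge φ e).k') (mapEdge φ e).k'
        (by have := (mapEdge φ e).hk'; omega) =
      entrySet e.π (e.π.length - e.k') e.k' (by have := e.hk'; omega) :=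
  congrArg (fun x => x.2.1) (φ.label_onE e)

/-- The label records the block length as a cardinality. -/
theorem mapEdge_k (e : Edge P) : (mapEdge φ e).k = e.k := by
  have := congrArg Finset.card (mapEdge_initial φ e)
  rwa [card_entrySet, card_entrySet] at this

theorem mapEdge_k' (e : Edge P) : (mapEdge φ e).k' = e.k' := by
  have := congrArg Finset.card (mapEdge_final φ e)
  rwa [card_entrySet, card_entrySet] at this

theorem mapEdge_adjacent {e f : Edge P}
    (h : stSubword e.π (e.π.length - e.k') e.k' (by have := e.hk'; omega) =
      stSubword f.π 0 f.k (by have := f.hk; omega)) :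
    stSubword (mapEdge φ e).π ((mapEdge φ e).π.length - (mapEdge φ e).k') (mapEdge φ e).k'
        (by have := (mapEdge φ e).hk'; omega) =
      stSubword (mapEdge φ f).π 0 (mapEdge φ f).k (by have := (mapEdge φ f).hk; omega) := by
  have h' : (patternGraph P).target e = (patternGraph P).source f := Subtype.ext h
  have := (φ.target_onE e).trans ((congrArg φ.onV h').trans (φ.source_onE f).symm)
  exact congrArg Subtype.val this

/-- The reindexing of positions on an edge when it is mapped by an isomorphism. -/
def edgeReindex (e : Edge P) : Equiv.Perm ℕ := reindex e.π (mapEdge φ e).π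

theorem edgeReindex_lt_iff (e : Edge P) {x : ℕ} :
    edgeReindex φ e x < e.π.length ↔ x < e.π.length :=
  reindex_lt_iff rfl (mapEdge_length φ e)

/-- On the common block both reindexings reduce to that of the shared vertex to its image under
`φ.onV`. -/
theorem edgeReindex_adjacent {e f : Edge P}
    (h : stSubword e.π (e.π.length - e.k') e.k' (by have := e.hk'; omega) =
      stSubword f.π 0 f.k (by have := f.hk; omega)) {x : ℕ} (hx : x < e.k') :
    edgeReindex φ e (e.π.length - e.k' + x) = e.π.length - e.k' + edgeReindex φ f x := by
  have hk : e.k' = f.k := congrArg Pattern.length h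
  have h1 := reindex_add_of_entrySet_eq _ _ (by rw [mapEdge_length, mapEdge_k'])
    (mapEdge_k' φ e) (mapEdge_final φ e) hx
  have h2 := reindex_add_of_entrySet_eq _ _ rfl (mapEdge_k φ f) (mapEdge_initial φ f)
    (x := x) (by omega)
  rw [edgeReindex, h1, h, mapEdge_adjacent φ h, edgeReindex]
  rw [zero_add, zero_add] at h2
  rw [h2]

/-- Both sides are the standardization of `σ` on the intersection of the two intervals. -/
theorem edgeAt_adjacent (hpos : ∀ π ∈ P, 0 < π.length) (hred : IsReduced P)
    (hJ : J ⊆ occurrenceIntervals P σ) {I I' : J} (hlt : I.1.1 < I'.1.1)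
    (hnext : ∀ I'' ∈ J, I.1.1 < I''.1 → I'.1.1 ≤ I''.1) (hov : I'.1.1 < I.1.1 + I.1.2) :
    stSubword (edgeAt hpos hred hJ I).π
        ((edgeAt hpos hred hJ I).π.length - (edgeAt hpos hred hJ I).k')
        (edgeAt hpos hred hJ I).k' (by have := (edgeAt hpos hred hJ I).hk'; omega) =
      stSubword (edgeAt hpos hred hJ I').π 0 (edgeAt hpos hred hJ I').k
        (by have := (edgeAt hpos hred hJ I').hk; omega) := by
  have hr := rightOverlap_eq I'.2 hlt hnext hov
  have hl := leftOverlap_eq (isIntervalAntichain_of_subset hred hJ) I.2 hlt hnext hov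
  have hle := rightOverlap_le hpos hJ I.2
  have hle' := leftOverlap_le hpos hred hJ I'.2
  refine (stSubword_stSubword _ _ (show I.1.2 - rightOverlap J I + rightOverlap J I ≤ _ by
    omega)).trans ((stSubword_congr _ _ ?_ (hr.trans hl.symm)).trans
      (stSubword_stSubword _ _ (show 0 + leftOverlap J I' ≤ _ by omega)).symm)
  omega

theorem compatible_edgeReindex (hpos : ∀ π ∈ P, 0 < π.length) (hred : IsReduced P)
    (hJ : J ⊆ occurrenceIntervals P σ) :
    Compatible J fun I => edgeReindex φ (edgeAt hpos hred hJ I) := by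
  refine compatible_of_neighbours (isIntervalAntichain_of_subset hred hJ) ?_
  intro I I' hlt hnext p hp hp'
  have hov : I'.1.1 < I.1.1 + I.1.2 := by omega
  have hr := rightOverlap_eq I'.2 hlt hnext hov
  obtain ⟨x, rfl⟩ := Nat.exists_eq_add_of_le hp
  have h := edgeReindex_adjacent φ (edgeAt_adjacent hpos hred hJ hlt hnext hov) (x := x)
    (show x < rightOverlap J I by omega)
  have ha : (edgeAt hpos hred hJ I).π.length - (edgeAt hpos hred hJ I).k' =
      I'.1.1 - I.1.1 := by
    change I.1.2 - rightOverlap J I = _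
    omega
  rw [ha] at h
  rw [Nat.add_sub_cancel_left, show I'.1.1 + x - I.1.1 = I'.1.1 - I.1.1 + x by omega, h]
  omega

/-! ### Transfer of permutations. -/

theorem exists_position_perm (hpos : ∀ π ∈ P, 0 < π.length) (hred : IsReduced P)
    (hJ : J ⊆ occurrenceIntervals P σ) :
    ∃ τ : Equiv.Perm (Fin n),
      ∀ p, (τ p : ℕ) = glue J (fun I => edgeReindex φ (edgeAt hpos hred hJ I)) p :=
  (compatible_edgeReindex φ hpos hred hJ).exists_perm
    (fun I _ => edgeReindex_lt_iff φ (edgeAt hpos hred hJ I)) fun _ hI => end_le_of_subset hJ hI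

/-- The permutation of positions that transfers all patterns of `σ` on the intervals of `J`. -/
noncomputable def positionPerm (hpos : ∀ π ∈ P, 0 < π.length) (hred : IsReduced P)
    (hJ : J ⊆ occurrenceIntervals P σ) : Equiv.Perm (Fin n) :=
  (exists_position_perm φ hpos hred hJ).choose

theorem positionPerm_apply (hpos : ∀ π ∈ P, 0 < π.length) (hred : IsReduced P)
    (hJ : J ⊆ occurrenceIntervals P σ) (p : Fin n) :
    (positionPerm φ hpos hred hJ p : ℕ) =
      glue J (fun I => edgeReindex φ (edgeAt hpos hred hJ I)) p :=
  (exists_position_perm φ hpos hred hJ).choose_spec p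

theorem extend_transfer (hpos : ∀ π ∈ P, 0 < π.length) (hred : IsReduced P)
    (hJ : J ⊆ occurrenceIntervals P σ) (I : J) {x : ℕ} (hx : x < I.1.2) :
    (Pattern.mk n (σ * positionPerm φ hpos hred hJ)).extend (I.1.1 + x) =
      (Pattern.mk n σ).extend (I.1.1 + edgeReindex φ (edgeAt hpos hred hJ I) x) := by
  have hn := end_le_of_subset hJ I.2
  have hlt : edgeReindex φ (edgeAt hpos hred hJ I) x < I.1.2 :=
    (edgeReindex_lt_iff φ (edgeAt hpos hred hJ I)).2 hx
  rw [Pattern.extend_apply _ (show I.1.1 + x < n by omega),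
    Pattern.extend_apply _ (show I.1.1 + edgeReindex φ (edgeAt hpos hred hJ I) x < n by omega)]
  simp only [Equiv.Perm.mul_apply]
  congr 2
  refine Fin.ext ?_
  rw [positionPerm_apply, (compatible_edgeReindex φ hpos hred hJ).glue_add I hx]

theorem stSubword_transfer (hpos : ∀ π ∈ P, 0 < π.length) (hred : IsReduced P)
    (hJ : J ⊆ occurrenceIntervals P σ) (I : J) :
    stSubword ⟨n, σ * positionPerm φ hpos hred hJ⟩ I.1.1 I.1.2 (end_le_of_subset hJ I.2) =
      (mapEdge φ (edgeAt hpos hred hJ I)).π := by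
  refine (stSubword_eq_iff _).2 ⟨(mapEdge_length φ (edgeAt hpos hred hJ I)).symm, ?_⟩
  intro x y hx hy
  rw [extend_transfer φ hpos hred hJ I hx, extend_transfer φ hpos hred hJ I hy,
    ← stSubword_extend_lt_iff _ (end_le_of_subset hJ I.2)
      ((edgeReindex_lt_iff φ (edgeAt hpos hred hJ I)).2 hx)
      ((edgeReindex_lt_iff φ (edgeAt hpos hred hJ I)).2 hy)]
  exact (congrArg₂ (· < ·) (extend_reindex (edgeAt hpos hred hJ I).π _ x)
    (extend_reindex (edgeAt hpos hred hJ I).π _ y)).symm.to_iff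

theorem subset_occurrenceIntervals_transfer (hpos : ∀ π ∈ P, 0 < π.length) (hred : IsReduced P)
    (hJ : J ⊆ occurrenceIntervals P σ) :
    J ⊆ occurrenceIntervals P' (σ * positionPerm φ hpos hred hJ) := by
  intro I hI
  refine mem_occurrenceIntervals.2 ⟨end_le_of_subset hJ hI, ?_⟩
  rw [stSubword_transfer φ hpos hred hJ ⟨I, hI⟩]
  exact (mapEdge φ _).mem

/-- The transferred permutation shows the image pattern on each interval, and `J` alone fixes the
overlap lengths. So it determines the image edges, hence the original edges, hence the permutation
of positions. -/
theorem transfer_injective (hpos : ∀ π ∈ P, 0 < π.length) (hred : IsReduced P)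
    {σ' : Equiv.Perm (Fin n)} (hJ : J ⊆ occurrenceIntervals P σ)
    (hJ' : J ⊆ occurrenceIntervals P σ')
    (h : σ * positionPerm φ hpos hred hJ = σ' * positionPerm φ hpos hred hJ') : σ = σ' := by
  have hedge (I : J) : edgeAt hpos hred hJ I = edgeAt hpos hred hJ' I := by
    refine mapEdge_injective φ (Edge.ext_of_eq ?_ ?_ ?_)
    · rw [← stSubword_transfer φ hpos hred hJ, ← stSubword_transfer φ hpos hred hJ']
      simp only [h]
    · rw [mapEdge_k, mapEdge_k, edgeAt_k, edgeAt_k]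
    · rw [mapEdge_k', mapEdge_k', edgeAt_k', edgeAt_k']
  have hτ : positionPerm φ hpos hred hJ = positionPerm φ hpos hred hJ' := by
    ext p
    rw [positionPerm_apply, positionPerm_apply]
    simp only [hedge]
  rw [hτ] at h
  exact mul_right_cancel h

theorem card_subset_occurrenceIntervals_le
    (φ : LabelledDigraph.Iso (patternGraph P) (patternGraph P'))
    (hpos : ∀ π ∈ P, 0 < π.length) (hred : IsReduced P) (n : ℕ) (J : Finset (ℕ × ℕ)) :
    {σ : Equiv.Perm (Fin n) | J ⊆ occurrenceIntervals P σ}.ncard ≤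
      {σ : Equiv.Perm (Fin n) | J ⊆ occurrenceIntervals P' σ}.ncard :=
  Set.ncard_le_ncard_of_injOn
    (fun σ => open Classical in if hJ : J ⊆ occurrenceIntervals P σ then
      σ * positionPerm φ hpos hred hJ else σ)
    (fun σ hσ => by
      rw [Set.mem_ofPred_eq] at hσ
      simp only [dif_pos hσ]
      exact subset_occurrenceIntervals_transfer φ hpos hred hσ)
    (fun σ hσ σ' hσ' h => by
      rw [Set.mem_ofPred_eq] at hσ hσ'
      simp only [dif_pos hσ, dif_pos hσ'] at h
      exact transfer_injective φ hpos hred hσ hσ' h)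
    (Set.toFinite _)

end Transfer

/-- The inverse of an isomorphism of labelled directed multigraphs. -/
def LabelledDigraph.Iso.symm {L : Type} {G H : LabelledDigraph L} (φ : G.Iso H) : H.Iso G where
  onV := φ.onV.symm
  onE := φ.onE.symm
  source_onE e := by
    rw [Equiv.eq_symm_apply, ← φ.source_onE, Equiv.apply_symm_apply]
  target_onE e := by
    rw [Equiv.eq_symm_apply, ← φ.target_onE, Equiv.apply_symm_apply]
  label_onE e := by
    rw [← φ.label_onE, Equiv.apply_symm_apply]

/-! ### Inclusion–exclusion -/

open Finset in
/-- Set-valued functions are equidistributed if, for each `J`, they contain `J` equally often. -/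
theorem card_eq_of_card_subset_eq {α β : Type*} [Fintype α] [DecidableEq β] {f g : α → Finset β}
    (h : ∀ J, #{a | J ⊆ f a} = #{a | J ⊆ g a}) (A : Finset β) :
    #{a | f a = A} = #{a | g a = A} := by
  classical
  obtain ⟨U, hf, hg⟩ : ∃ U : Finset β, (∀ a, f a ⊆ U) ∧ ∀ a, g a ⊆ U :=
    ⟨univ.biUnion fun a => f a ∪ g a,
      fun a => subset_union_left.trans (subset_biUnion_of_mem (fun a => f a ∪ g a) (mem_univ a)),
      fun a => subset_union_right.trans (subset_biUnion_of_mem (fun a => f a ∪ g a) (mem_univ a))⟩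
  have hsum (F : α → Finset β) (hF : ∀ a, F a ⊆ U) (A : Finset β) :
      #{a | A ⊆ F a} = #{a | F a = A} + ∑ B ∈ U.powerset with A ⊂ B, #{a | F a = B} := by
    rw [← card_biUnion, ← card_union_of_disjoint]
    · congr 1
      ext a
      simp only [mem_filter, mem_univ, true_and, mem_union, mem_biUnion, mem_powerset]
      constructor
      · intro h
        rcases h.eq_or_ssubset with h | h
        · exact Or.inl h.symm
        · exact Or.inr ⟨F a, ⟨hF a, h⟩, rfl⟩
      · rintro (h | ⟨B, ⟨-, h⟩, rfl⟩)
        · exact h.ge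
        · exact h.subset
    · rw [disjoint_biUnion_right]
      intro B hB
      rw [mem_filter] at hB
      rw [disjoint_filter]
      rintro a - rfl rfl
      exact hB.2.ne rfl
    · intro B _ C _ hBC
      rw [Function.onFun, disjoint_filter]
      rintro a - rfl
      exact hBC
  -- Downward induction on `A`: whenever `A ⊂ B ⊆ U`, the difference `#U - #B` is strictly smaller,
  -- so the counts for proper supersets cancel.
  suffices H : ∀ (d : ℕ) (A : Finset β), #U - #A = d → #{a | f a = A} = #{a | g a = A} from
    H _ A rfl
  intro d
  induction d using Nat.strong_induction_on with
  | _ d ih =>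
    intro A hA
    have h1 := h A
    rw [hsum f hf, hsum g hg] at h1
    have h2 : ∑ B ∈ U.powerset with A ⊂ B, #{a | f a = B} =
        ∑ B ∈ U.powerset with A ⊂ B, #{a | g a = B} := by
      refine sum_congr rfl fun B hB => ?_
      rw [mem_filter, mem_powerset] at hB
      have := card_lt_card hB.2
      have := card_le_card hB.1
      exact ih _ (by omega) B rfl
    omega

open Finset in
theorem card_card_eq_of_card_subset_eq {α β : Type*} [Fintype α] [DecidableEq β]
    {f g : α → Finset β} (h : ∀ J, #{a | J ⊆ f a} = #{a | J ⊆ g a}) (q : ℕ) :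
    #{a | #(f a) = q} = #{a | #(g a) = q} := by
  have hsum (F : α → Finset β) (S : Finset (Finset β)) (hS : ∀ a, F a ∈ S) :
      #{a | #(F a) = q} = ∑ A ∈ S with #A = q, #{a | F a = A} := by
    rw [card_eq_sum_card_fiberwise (f := F) (t := {A ∈ S | #A = q})]
    · refine sum_congr rfl fun A hA => ?_
      rw [mem_filter] at hA
      rw [filter_filter]
      congr 1
      ext a
      simp only [mem_filter, mem_univ, true_and, and_iff_right_iff_imp]
      rintro rfl
      exact hA.2
    · intro a ha
      have ha : #(F a) = q := by simpa using ha
      simpa using ⟨hS a, ha⟩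
  rw [hsum f (univ.image f ∪ univ.image g) (by simp),
    hsum g (univ.image f ∪ univ.image g) (by simp)]
  exact sum_congr rfl fun A _ => card_eq_of_card_subset_eq h A

end ConsecutivePatterns

theorem corollary2p2 (P₁ P₂ : Set ConsecutivePatterns.Pattern)
    (hpos₁ : ∀ π ∈ P₁, 0 < π.length) (hpos₂ : ∀ π ∈ P₂, 0 < π.length)
    (hred₁ : ConsecutivePatterns.IsReduced P₁) (hred₂ : ConsecutivePatterns.IsReduced P₂)
    (hG : Nonempty (ConsecutivePatterns.LabelledDigraph.Iso
      (ConsecutivePatterns.patternGraph P₁) (ConsecutivePatterns.patternGraph P₂))) :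
    ConsecutivePatterns.StronglyCWilfEquivalent P₁ P₂ := by
  obtain ⟨φ⟩ := hG
  intro n _ q _
  have h := ConsecutivePatterns.card_card_eq_of_card_subset_eq
    (f := fun σ : Equiv.Perm (Fin n) => ConsecutivePatterns.occurrenceIntervals P₁ σ)
    (g := fun σ : Equiv.Perm (Fin n) => ConsecutivePatterns.occurrenceIntervals P₂ σ)
    (fun J => by
      have h := (ConsecutivePatterns.card_subset_occurrenceIntervals_le φ hpos₁ hred₁ n J).antisymm
        (ConsecutivePatterns.card_subset_occurrenceIntervals_le φ.symm hpos₂ hred₂ n J)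
      simpa only [Set.ncard_eq_toFinset_card', Set.toFinset_ofPred] using h) q
  simpa only [ConsecutivePatterns.countWithOccurrences, ConsecutivePatterns.ncard_occurrences,
    Set.ncard_eq_toFinset_card', Set.toFinset_ofPred] using h
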